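/- Let $G$ be an Abelian group. For integers $n,d\ge 0$ let $\mathcal{P}_d(\{0,1\}^n,G)$ be the set of functions $P:\{0,1\}^n\to G$ of the form $P(x)=\sum_{S\subseteq[n],\,|S|\le d} c_S\prod_{i\in S}x_i$ with coefficients $c_S\in G$, where the product is taken over the integers. For $f,g:\{0,1\}^n\to G$ let $\delta(f,g)$ be the fraction of points of $\{0,1\}^n$ at which $f$ and $g$ differ. A set $\mathcal{F}$ of functions $\{0,1\}^n\to G$ has a $(\delta,q)$-local correction algorithm if there is a probabilistic (adaptive) query algorithm that makes at most $q$ queries to its oracle and that, for every $f:\{0,1\}^n\to G$ and every $P\in\mathcal{F}$ with $\delta(f,P)\le\delta$, when given oracle access to $f$ and any input $\mathbf{a}\in\{0,1\}^n$, outputs $P(\mathbf{a})$ with probability at least $3/4$. The exponent of a torsion group is the least common multiple of the orders of its elements. **Theorem 1.2.** For every integer $M\ge 1$ and every real $\varepsilon>0$ there is a number $q=\mathcal{O}_{M,\varepsilon}(1)$, depending only on $M$ and $\varepsilon$, such that for every Abelian torsion group $G$ of exponent $M$, every $d\ge 0$ and every $n\ge 0$, the space $\mathcal{P}_d(\{0,1\}^n,G)$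 has a $(\delta,q)$-local correction algorithm with $\delta=\frac{1}{2^{d+1}}-\varepsilon$. -/

import Mathlib

/-- The Boolean cube `{0,1}^n`. -/
abbrev BoolCube (n : ℕ) : Type := Fin n → Bool

/-- The functions `{0,1}^n → G` of the form `x ↦ ∑_{|S| ≤ d} c_S ∏_{i ∈ S} x_i`, where the product is
a product of integers (each `x_i` being `0` or `1`) and the coefficients `c_S` lie in `G`. -/
def polySpace (d n : ℕ) (G : Type*) [AddCommGroup G] : Set (BoolCube n → G) :=
  {P | ∃ c : Finset (Fin n) → G, ∀ x : BoolCube n,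
    P x = ∑ S : Finset (Fin n) with S.card ≤ d, (∏ i ∈ S, (x i).toNat) • c S}

open Classical in
/-- The fraction of the points of `{0,1}^n` at which `f` and `g` differ. -/
noncomputable def relDist {n : ℕ} {G : Type*} (f g : BoolCube n → G) : ℝ :=
  (hammingDist f g : ℝ) / (2 : ℝ) ^ n

/-- A deterministic, adaptive query algorithm with oracle access to a function `{0,1}^n → G` and with
output in `G`: it either stops and returns an element of `G`, or queries the oracle at a point and
continues in a way that depends on the answer. -/
inductive QueryAlg (n : ℕ) (G : Type*) where
  | ret (g : G) : QueryAlg n G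
  | query (x : BoolCube n) (next : G → QueryAlg n G) : QueryAlg n G

namespace QueryAlg

/-- The output of the algorithm on the oracle `f`. -/
def output {n : ℕ} {G : Type*} (f : BoolCube n → G) : QueryAlg n G → G
  | ret g => g
  | query x next => output f (next (f x))

/-- The number of queries that the algorithm makes to the oracle `f`. -/
def numQueries {n : ℕ} {G : Type*} (f : BoolCube n → G) : QueryAlg n G → ℕ
  | ret _ => 0
  | query x next => numQueries f (next (f x)) + 1

end QueryAlg

/-- A probabilistic query algorithm that takes a point of `{0,1}^n` as input: it draws a seed uniformly
from a finite nonempty set; the seed and the input point determine the query algorithm it runs. -/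
structure ProbQueryAlg (n : ℕ) (G : Type*) where
  Seed : Type
  [seedFintype : Fintype Seed]
  [seedNonempty : Nonempty Seed]
  alg : Seed → BoolCube n → QueryAlg n G

attribute [instance] ProbQueryAlg.seedFintype ProbQueryAlg.seedNonempty

open Classical in
/-- The probability, over the seed, that `A` with oracle `f` and input `a` outputs `g`. -/
noncomputable def ProbQueryAlg.probOutput {n : ℕ} {G : Type*} (A : ProbQueryAlg n G)
    (f : BoolCube n → G) (a : BoolCube n) (g : G) : ℝ :=
  ((Finset.univ.filter fun s : A.Seed => (A.alg s a).output f = g).card : ℝ) /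
    (Fintype.card A.Seed : ℝ)

/-- The space `F` of functions `{0,1}^n → G` has a `(δ, q)`-local correction algorithm: a probabilistic
algorithm which never makes more than `q` queries and which, given oracle access to any `f` that is
`δ`-close to some `P ∈ F` and given any point `a`, outputs `P a` with probability at least `3/4`. -/
def HasLocalCorrection {n : ℕ} {G : Type*} (F : Set (BoolCube n → G)) (δ : ℝ) (q : ℕ) : Prop :=
  ∃ A : ProbQueryAlg n G,
    (∀ (f : BoolCube n → G) (a : BoolCube n) (s : A.Seed), (A.alg s a).numQueries f ≤ q) ∧
    ∀ (f P : BoolCube n → G), P ∈ F → relDist f P ≤ δ →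
      ∀ a : BoolCube n, 3 / 4 ≤ A.probOutput f a (P a)

/-! Work with sums of functions of at most `d` coordinates: this class survives translation and the
identification of variables, and contains `polySpace`. Put `L = M * d!`.

To correct at `a`, take a random map from the `n` coordinates to `2L` blocks. This embeds a
`2L`-dimensional cube with origin `a`. As `M` kills `G`, `P a` is a sum of values of `P` at embedded
points of weight `L` (`sum_powersetCard_eq_bot`). Such points are balanced, so each is uniform in
`{0,1}^n` (`sum_comp_balanced`).

Each of these values is recovered from a further random subcube, of dimension `2 ^ r`, based at that
point. By a second-moment bound the error rate there is rarely `ε` above its global value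
(`card_bad_subcube_le`). It then stays below `1 / 2 ^ (d + 1)`, half the minimum distance, and
unique decoding inside the subcube returns the value. A union bound over the base points finishes.

The query count depends only on `M`, `d`, `r`. Large `d` makes the radius negative, so finitely many
`d` matter. -/

open scoped symmDiff

/-! ### Sums of juntas, their minimum distance, and unique decoding. -/

section JuntaSpan

variable {ι κ G : Type*} [AddCommGroup G]

/-- The subgroup of functions on the cube generated by the functions that depend on at most `d`
coordinates. -/
def juntaSpan (ι G : Type*) [AddCommGroup G] (d : ℕ) : AddSubgroup ((ι → Bool) → G) :=
  AddSubgroup.closure {F | ∃ T : Finset ι, T.card ≤ d ∧ DependsOn F (T : Set ι)}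

theorem mem_juntaSpan_of_dependsOn {d : ℕ} {F : (ι → Bool) → G} (T : Finset ι) (hT : T.card ≤ d)
    (hF : DependsOn F (T : Set ι)) : F ∈ juntaSpan ι G d :=
  AddSubgroup.subset_closure ⟨T, hT, hF⟩

/-- After the substitution the monomial of `S` depends only on the coordinates in the image of `S`
under `h`, which has at most `|S|` elements. -/
theorem polySpace_comp_mem_juntaSpan {d n : ℕ} {P : BoolCube n → G} (hP : P ∈ polySpace d n G)
    (a : BoolCube n) (h : Fin n → κ) : (fun v : κ → Bool => P (a ∆ (v ∘ h))) ∈ juntaSpan κ G d := by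
  classical
  obtain ⟨c, hc⟩ := hP
  have : (fun v : κ → Bool => P (a ∆ (v ∘ h))) =
      ∑ S : Finset (Fin n) with S.card ≤ d,
        fun v : κ → Bool => (∏ i ∈ S, ((a ∆ (v ∘ h)) i).toNat) • c S := by
    ext v
    simp [hc]
  rw [this]
  refine AddSubgroup.sum_mem _ fun S hS => ?_
  refine mem_juntaSpan_of_dependsOn (S.image h)
    (Finset.card_image_le.trans (Finset.mem_filter.1 hS).2) ?_
  intro v w hvw
  dsimp only
  congr 1
  refine Finset.prod_congr rfl fun i hi => ?_
  have : v (h i) = w (h i) := hvw _ (by simpa using ⟨i, hi, rfl⟩)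
  simp [Pi.symmDiff_apply, this]

theorem const_of_mem_juntaSpan_zero {F : (ι → Bool) → G} (hF : F ∈ juntaSpan ι G 0)
    (x y : ι → Bool) : F x = F y := by
  induction hF using AddSubgroup.closure_induction with
  | mem F hF =>
    obtain ⟨T, hT, hF⟩ := hF
    apply hF
    have : T = ∅ := by simpa using hT
    simp [this]
  | zero => rfl
  | add F H _ _ h₁ h₂ => simp [h₁, h₂]
  | neg F _ h => simp [h]

theorem const_of_update_eq {β : Type*} [Finite ι] [DecidableEq ι] {F : (ι → Bool) → β}
    (hF : ∀ i x, F (Function.update x i true) = F (Function.update x i false))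
    (x y : ι → Bool) : F x = F y := by
  have step : ∀ (i : ι) (b : Bool) (x : ι → Bool), F (Function.update x i b) = F x := by
    intro i b x
    have key : ∀ b, F (Function.update x i b) = F (Function.update x i false) := by
      intro b
      cases b
      · rfl
      · exact hF i x
    rw [key b, ← key (x i), Function.update_eq_self]
  cases nonempty_fintype ι
  have h : ∀ s : Finset ι, F (s.piecewise x y) = F y := by
    intro s
    induction s using Finset.induction_on with
    | empty => simp
    | insert i s _ ih => rw [Finset.piecewise_insert, step, ih]
  simpa using h Finset.univ

/-- The discrete derivative in direction `i` kills a junta on `T` if `i ∉ T`, and otherwise leaves a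
junta on `T.erase i`. -/
theorem difference_mem_juntaSpan [DecidableEq ι] {d : ℕ} {F : (ι → Bool) → G}
    (hF : F ∈ juntaSpan ι G (d + 1)) (i : ι) :
    (fun x => F (Function.update x i true) - F (Function.update x i false)) ∈ juntaSpan ι G d := by
  induction hF using AddSubgroup.closure_induction with
  | mem F hF =>
    obtain ⟨T, hT, hF⟩ := hF
    by_cases hi : i ∈ T
    · refine mem_juntaSpan_of_dependsOn (T.erase i) (by rw [Finset.card_erase_of_mem hi]; omega) ?_
      intro x y hxy
      have : ∀ b, F (Function.update x i b) = F (Function.update y i b) := by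
        intro b
        apply hF
        intro j hj
        by_cases hji : j = i
        · subst hji; simp
        · simpa [hji] using hxy j (by simpa [hji] using hj)
      simp [this]
    · convert (juntaSpan ι G d).zero_mem using 1
      ext x
      rw [Pi.zero_apply, sub_eq_zero]
      apply hF
      intro j hj
      have hji : j ≠ i := by
        rintro rfl
        exact hi hj
      simp [hji]
  | zero =>
    convert (juntaSpan ι G d).zero_mem using 1
    ext x
    simp
  | add F H _ _ h₁ h₂ =>
    convert (juntaSpan ι G d).add_mem h₁ h₂ using 1
    ext x
    simp only [Pi.add_apply]
    abel
  | neg F _ h =>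
    convert (juntaSpan ι G d).neg_mem h using 1
    ext x
    simp only [Pi.neg_apply]
    abel

open Classical in
/-- A nonzero polynomial of degree at most `d` is nonzero on at least a `1 / 2 ^ d` fraction of the
cube. -/
theorem two_pow_card_le_card_support [Fintype ι] {d : ℕ} {F : (ι → Bool) → G}
    (hF : F ∈ juntaSpan ι G d) (h0 : F ≠ 0) :
    2 ^ Fintype.card ι ≤ 2 ^ d * (Finset.univ.filter fun x => F x ≠ 0).card := by
  have hconst : ∀ {F : (ι → Bool) → G}, F ≠ 0 → (∀ x y, F x = F y) →
      2 ^ Fintype.card ι ≤ (Finset.univ.filter fun x => F x ≠ 0).card := by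
    intro F h0 hc
    obtain ⟨x, hx⟩ := Function.ne_iff.1 h0
    rw [Finset.filter_true_of_mem fun y _ => by rw [hc y x]; exact hx]
    simp
  induction d generalizing F with
  | zero => simpa using hconst h0 (const_of_mem_juntaSpan_zero hF)
  | succ d ih =>
    by_cases hd : ∀ i x, F (Function.update x i true) = F (Function.update x i false)
    · exact (hconst h0 (const_of_update_eq hd)).trans (Nat.le_mul_of_pos_left _ (by positivity))
    push Not at hd
    obtain ⟨i, x, hx⟩ := hd
    set H : (ι → Bool) → G := fun x => F (Function.update x i true) - F (Function.update x i false)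
      with hH
    have hH0 : H ≠ 0 := fun h => hx (sub_eq_zero.1 (congrFun h x))
    have h1 := ih (difference_mem_juntaSpan hF i) hH0
    have hinv : ∀ y : ι → Bool, Function.update (Function.update y i (!y i)) i
        (!(Function.update y i (!y i)) i) = y := by
      intro y; simp
    -- If the derivative is nonzero at `y`, then `F` is nonzero at `y` or at its neighbour in
    -- direction `i`. So the support of `H` is at most twice that of `F`.
    have h2 : (Finset.univ.filter fun x => H x ≠ 0) ⊆
        (Finset.univ.filter fun x => F x ≠ 0) ∪
          (Finset.univ.filter fun x => F x ≠ 0).image fun y => Function.update y i (!y i) := by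
      intro y hy
      simp only [Finset.mem_filter, Finset.mem_univ, true_and, Finset.mem_union,
        Finset.mem_image] at hy ⊢
      by_contra hcon
      push Not at hcon
      obtain ⟨hc1, hc2⟩ := hcon
      have hc3 : F (Function.update y i (!y i)) = 0 := by
        by_contra hne
        exact hc2 _ hne (hinv y)
      have hall : ∀ b, F (Function.update y i b) = 0 := by
        intro b
        by_cases hb : b = y i
        · rw [hb, Function.update_eq_self, hc1]
        · rwa [show b = !y i by revert hb; cases b <;> cases y i <;> simp]
      exact hy (by simp [hH, hall])
    have h3 := (Finset.card_le_card h2).trans (Finset.card_union_le _ _)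
    have h4 : ((Finset.univ.filter fun x => F x ≠ 0).image fun y : ι → Bool =>
        Function.update y i (!y i)).card ≤ (Finset.univ.filter fun x => F x ≠ 0).card :=
      Finset.card_image_le
    calc 2 ^ Fintype.card ι ≤ 2 ^ d * (Finset.univ.filter fun x => H x ≠ 0).card := h1
      _ ≤ 2 ^ d * (2 * (Finset.univ.filter fun x => F x ≠ 0).card) :=
        Nat.mul_le_mul_left _ (by omega)
      _ = _ := by ring

open Classical in
/-- The value at the origin of a polynomial of degree at most `d` that is within half the minimum
distance of `f`, or `0` if there is no such polynomial. -/
noncomputable def decodeAtBot [Fintype ι] (d : ℕ) (f : (ι → Bool) → G) : G :=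
  if h : ∃ Q ∈ juntaSpan ι G d, 2 ^ (d + 1) * hammingDist f Q < 2 ^ Fintype.card ι then
    h.choose ⊥
  else 0

-- Two candidates this close to `f` would have a difference whose support is below the minimum
-- distance, so the choice in `decodeAtBot` does not matter.
open Classical in
theorem decodeAtBot_eq [Fintype ι] {d : ℕ} {f Q : (ι → Bool) → G} (hQ : Q ∈ juntaSpan ι G d)
    (hf : 2 ^ (d + 1) * hammingDist f Q < 2 ^ Fintype.card ι) : decodeAtBot d f = Q ⊥ := by
  have h : ∃ Q ∈ juntaSpan ι G d, 2 ^ (d + 1) * hammingDist f Q < 2 ^ Fintype.card ι := ⟨Q, hQ, hf⟩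
  rw [decodeAtBot, dif_pos h]
  obtain ⟨h1, h2⟩ := h.choose_spec
  generalize h.choose = R at h1 h2
  by_contra hne
  have h3 := two_pow_card_le_card_support ((juntaSpan ι G d).sub_mem h1 hQ)
    (fun h0 => hne (sub_eq_zero.1 (congrFun h0 ⊥)))
  have h4 : (Finset.univ.filter fun x => (R - Q) x ≠ 0).card = hammingDist R Q := by
    simp [hammingDist, sub_ne_zero]
  have h5 := hammingDist_triangle_left R Q f
  rw [h4] at h3
  have h6 := h3.trans (Nat.mul_le_mul_left (2 ^ d) h5)
  rw [pow_succ] at hf h2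
  nlinarith

end JuntaSpan

/-! ### Interpolating the value at the origin from one layer, modulo `M`. -/

section Interpolation

/-- With `N = M * d!`, `i * C(N, i) = N * C(N - 1, i - 1)`, and `i` divides `d!`, so cancelling `i`
leaves the factor `M`. -/
theorem dvd_choose_mul_factorial {M d i : ℕ} (hi : 0 < i) (hid : i ≤ d) :
    M ∣ (M * d.factorial).choose i := by
  obtain ⟨j, rfl⟩ : ∃ j, i = j + 1 := ⟨i - 1, by omega⟩
  rcases Nat.eq_zero_or_pos (M * d.factorial) with h | h
  · simp [h]
  obtain ⟨L, hL⟩ : ∃ L, M * d.factorial = L + 1 := ⟨_, (Nat.succ_pred_eq_of_pos h).symm⟩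
  obtain ⟨e, he⟩ := Nat.dvd_factorial hi hid
  have h1 := Nat.add_one_mul_choose_eq L j
  rw [hL]
  refine ⟨e * L.choose j, Nat.eq_of_mul_eq_mul_right hi ?_⟩
  rw [← h1, ← hL, he]
  ring

/-- In Vandermonde's identity every term except the one at `(0, e)` is divisible by `M`. -/
theorem choose_mul_factorial_add_modEq {M d e : ℕ} (x : ℕ) (he : e ≤ d) :
    (M * d.factorial + x).choose e ≡ x.choose e [MOD M] := by
  rw [Nat.add_choose_eq, ← Finset.sum_erase_add _ _ (show (0, e) ∈ Finset.HasAntidiagonal.antidiagonal e by simp)]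
  have : M ∣ ∑ ij ∈ (Finset.HasAntidiagonal.antidiagonal e).erase (0, e),
      (M * d.factorial).choose ij.1 * x.choose ij.2 := by
    refine Finset.dvd_sum fun ij hij => ?_
    rw [Finset.mem_erase, Finset.HasAntidiagonal.mem_antidiagonal] at hij
    refine Dvd.dvd.mul_right (dvd_choose_mul_factorial ?_ (by omega)) _
    rcases Nat.eq_zero_or_pos ij.1 with h | h
    · exact absurd (Prod.ext h (by simp; omega)) hij.1
    · exact h
  simpa using (Nat.modEq_zero_iff_dvd.2 this).add_right (x.choose e)

theorem card_powersetCard_filter_inter_eq {ι : Type*} [DecidableEq ι] {U T B : Finset ι} {L : ℕ}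
    (hB : B ⊆ U ∩ T) (hL : B.card ≤ L) :
    ((U.powersetCard L).filter fun A => A ∩ T = B).card = (U \ T).card.choose (L - B.card) := by
  have hBT : B ⊆ T := hB.trans Finset.inter_subset_right
  have hBU : B ⊆ U := hB.trans Finset.inter_subset_left
  rw [← Finset.card_powersetCard]
  refine Finset.card_nbij' (fun A => A \ T) (fun C => B ∪ C) ?_ ?_ ?_ ?_
  · intro A hA
    simp only [Finset.mem_coe, Finset.mem_filter, Finset.mem_powersetCard] at hA ⊢
    obtain ⟨⟨h1, h2⟩, h3⟩ := hA
    refine ⟨Finset.sdiff_subset_sdiff h1 subset_rfl, ?_⟩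
    have := Finset.card_sdiff_add_card_inter A T
    rw [h3] at this
    omega
  · intro C hC
    simp only [Finset.mem_coe, Finset.mem_filter, Finset.mem_powersetCard] at hC ⊢
    obtain ⟨h1, h2⟩ := hC
    have hd : Disjoint T C := Finset.disjoint_of_subset_right h1 Finset.disjoint_sdiff
    refine ⟨⟨Finset.union_subset hBU (h1.trans Finset.sdiff_subset), ?_⟩, ?_⟩
    · rw [Finset.card_union_of_disjoint (Finset.disjoint_of_subset_left hBT hd)]
      omega
    · rw [Finset.union_inter_distrib_right, Finset.inter_eq_left.2 hBT,
        Finset.disjoint_iff_inter_eq_empty.1 hd.symm, Finset.union_empty]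
  · intro A hA
    dsimp only
    rw [← (Finset.mem_filter.1 hA).2, Finset.union_comm, Finset.sdiff_union_inter]
  · intro C hC
    simp only [Finset.mem_coe, Finset.mem_powersetCard] at hC
    dsimp only
    have hd : Disjoint C T := Finset.disjoint_of_subset_left hC.1 Finset.sdiff_disjoint
    rw [Finset.union_sdiff_distrib, Finset.sdiff_eq_empty_iff_subset.2 hBT, Finset.empty_union,
      Finset.sdiff_eq_self_of_disjoint hd]

theorem nsmul_eq_of_modEq {G : Type*} [AddCommGroup G] {M a b : ℕ} (hM : ∀ g : G, M • g = 0)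
    (h : a ≡ b [MOD M]) (g : G) : a • g = b • g := by
  rw [← Nat.mod_add_div a M, ← Nat.mod_add_div b M, h, add_nsmul, add_nsmul, mul_nsmul', mul_nsmul',
    hM, hM]

/-- In a group of exponent dividing `M`, the value at the origin of a polynomial of degree at most
`d` is the sum of its values at the points of weight `M * d!` supported in a set of size
`M * d! + d`. -/
theorem sum_powersetCard_eq_bot {ι G : Type*} [DecidableEq ι] [AddCommGroup G] {M d : ℕ}
    (hM : ∀ g : G, M • g = 0) (hd : d ≤ M * d.factorial) {U : Finset ι}
    (hU : U.card = M * d.factorial + d)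
    {F : (ι → Bool) → G} (hF : F ∈ juntaSpan ι G d) :
    ∑ A ∈ U.powersetCard (M * d.factorial), F (fun j => decide (j ∈ A)) = F ⊥ := by
  induction hF using AddSubgroup.closure_induction with
  | mem F hF =>
    obtain ⟨T, hT, hF⟩ := hF
    set L := M * d.factorial with hL
    -- For a junta on `T` the summand depends only on the trace `A ∩ T`, so the sum is grouped by
    -- traces `B`.
    have hmaps : ∀ A ∈ U.powersetCard L, A ∩ T ∈ (U ∩ T).powerset := by
      intro A hA
      rw [Finset.mem_powerset]
      exact Finset.inter_subset_inter_right (Finset.mem_powersetCard.1 hA).1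
    rw [← Finset.sum_fiberwise_of_maps_to hmaps]
    have hcard := Finset.card_sdiff_add_card_inter U T
    have hUT : (U ∩ T).card ≤ d := (Finset.card_le_card Finset.inter_subset_right).trans hT
    have hterm : ∀ B ∈ (U ∩ T).powerset,
        ∑ A ∈ U.powersetCard L with A ∩ T = B, F (fun j => decide (j ∈ A)) =
          (d - (U ∩ T).card).choose (d - (U ∩ T).card + B.card) • F (fun j => decide (j ∈ B)) := by
      intro B hB
      rw [Finset.mem_powerset] at hB
      have hBc := Finset.card_le_card hB
      have h1 : ∀ A ∈ (U.powersetCard L).filter (fun A => A ∩ T = B),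
          F (fun j => decide (j ∈ A)) = F (fun j => decide (j ∈ B)) := by
        intro A hA
        apply hF
        intro j hj
        have hj' : j ∈ T := hj
        simp [← (Finset.mem_filter.1 hA).2, hj']
      rw [Finset.sum_congr rfl h1, Finset.sum_const,
        card_powersetCard_filter_inter_eq hB (by omega)]
      -- Reflecting the binomial coefficient makes its lower index at most `d`, so `L` can be
      -- dropped from the upper index modulo `M`.
      refine nsmul_eq_of_modEq hM ?_ _
      have h2 : (U \ T).card = L + (d - (U ∩ T).card) := by omega
      have h3 : (U \ T).card.choose (L - B.card) =
          (L + (d - (U ∩ T).card)).choose (d - (U ∩ T).card + B.card) := by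
        rw [h2]
        apply Nat.choose_symm_of_eq_add
        omega
      rw [h3]
      exact choose_mul_factorial_add_modEq _ (by omega)
    -- For nonempty `B` the lower index exceeds the upper one, so only the empty trace survives,
    -- with coefficient `1`.
    rw [Finset.sum_congr rfl hterm, Finset.sum_eq_single_of_mem ∅ (Finset.empty_mem_powerset _)]
    · simp only [Finset.card_empty, add_zero, Nat.choose_self, one_smul, Finset.notMem_empty,
        decide_false]
      rfl
    · intro B _ hB
      rw [Nat.choose_eq_zero_of_lt, zero_smul]
      have := Finset.card_pos.2 (Finset.nonempty_iff_ne_empty.2 hB)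
      omega
  | zero => simp
  | add F H _ _ h₁ h₂ => simp [Finset.sum_add_distrib, h₁, h₂]
  | neg F _ h => simp [h]

end Interpolation

/-! ### Random embedded subcubes as samplers. -/

section Sampling

variable {ι κ : Type*} [Fintype ι] [Fintype κ] [DecidableEq ι]

theorem sum_symmDiff {R : Type*} [AddCommMonoid R] (a : ι → Bool) (g : (ι → Bool) → R) :
    ∑ x, g (a ∆ x) = ∑ x, g x :=
  Equiv.sum_comp (symmDiff_right_involutive a).toPerm g

/-- Composition of a balanced `w : κ → Bool` with a uniformly random map `ι → κ` is a uniformly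
random point of the cube. -/
theorem sum_comp_balanced {w : κ → Bool} {m : ℕ}
    (hw : ∀ b, (Finset.univ.filter fun j => w j = b).card = m) (g : (ι → Bool) → ℝ) :
    ∑ h : ι → κ, g (w ∘ h) = (m : ℝ) ^ Fintype.card ι * ∑ x, g x := by
  classical
  rw [← Finset.sum_fiberwise Finset.univ (fun h : ι → κ => w ∘ h), Finset.mul_sum]
  refine Finset.sum_congr rfl fun x _ => ?_
  have h1 : ∀ h ∈ Finset.univ.filter (fun h : ι → κ => w ∘ h = x), g (w ∘ h) = g x := by
    intro h hh
    rw [(Finset.mem_filter.1 hh).2]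
  have h2 : Finset.univ.filter (fun h : ι → κ => w ∘ h = x) =
      Fintype.piFinset fun i => Finset.univ.filter fun j => w j = x i := by
    ext h
    simp [funext_iff]
  rw [Finset.sum_congr rfl h1, Finset.sum_const, h2, Fintype.card_piFinset]
  simp [hw]

/-- Translating `x` by `u ∘ h` turns the second factor into `g (x ∆ ((u ∆ v) ∘ h))`. For fixed `x`
and random `h` its argument is uniform because `u ∆ v` is balanced, so its mean is zero. -/
theorem sum_symmDiff_comp_mul_eq_zero [DecidableEq κ] {g : (ι → Bool) → ℝ} (hg : ∑ x, g x = 0)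
    {u v : κ → Bool}
    {m : ℕ} (hw : ∀ b, (Finset.univ.filter fun j => (u ∆ v) j = b).card = m) :
    ∑ x, ∑ h : ι → κ, g (x ∆ (u ∘ h)) * g (x ∆ (v ∘ h)) = 0 := by
  have h1 : ∀ h : ι → κ, ∑ x, g (x ∆ (u ∘ h)) * g (x ∆ (v ∘ h)) =
      ∑ x, g x * g (x ∆ ((u ∆ v) ∘ h)) := by
    intro h
    rw [← sum_symmDiff (u ∘ h)]
    refine Finset.sum_congr rfl fun x _ => ?_
    have e1 : (u ∘ h) ∆ x ∆ (u ∘ h) = x := by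
      rw [symmDiff_comm, symmDiff_symmDiff_cancel_left]
    have e2 : (u ∘ h) ∆ x ∆ (v ∘ h) = x ∆ ((u ∆ v) ∘ h) := by
      rw [symmDiff_comm (u ∘ h) x, symmDiff_assoc]
      rfl
    rw [e1, e2]
  rw [Finset.sum_comm, Finset.sum_congr rfl fun h _ => h1 h, Finset.sum_comm]
  refine Finset.sum_eq_zero fun x _ => ?_
  rw [← Finset.mul_sum, sum_comp_balanced hw fun y => g (x ∆ y), sum_symmDiff, hg]
  simp

/-- If the words `c i` are pairwise at distance half the length, then the mean of `g` over a random
embedded subcube has variance at most the inverse of the number of words. -/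
theorem sum_sq_sum_subcube_le [DecidableEq κ] {g : (ι → Bool) → ℝ} (hg : ∑ x, g x = 0)
    (hg1 : ∀ x, |g x| ≤ 1)
    {r m : ℕ} {c : Fin r → κ → Bool}
    (hc : ∀ i j, i ≠ j → ∀ b, (Finset.univ.filter fun k => (c i ∆ c j) k = b).card = m) :
    r * ∑ x, ∑ h : ι → κ, (∑ z : κ → Bool, g (x ∆ (z ∘ h))) ^ 2 ≤
      (2 ^ Fintype.card κ) ^ 2 * (2 ^ Fintype.card ι * (Fintype.card κ : ℝ) ^ Fintype.card ι) := by
  rcases Nat.eq_zero_or_pos r with rfl | hr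
  · simp only [Nat.cast_zero, zero_mul]
    positivity
  have hr' : (0 : ℝ) < r := by exact_mod_cast hr
  -- On each translate of the words the cross terms vanish, leaving `r` diagonal terms instead of `r
  -- ^ 2`.
  have hcoset : ∀ z : κ → Bool,
      ∑ x, ∑ h : ι → κ, (∑ i, g (x ∆ ((c i ∆ z) ∘ h))) ^ 2 ≤
        r * (2 ^ Fintype.card ι * (Fintype.card κ : ℝ) ^ Fintype.card ι) := by
    intro z
    have e : ∑ x, ∑ h : ι → κ, (∑ i, g (x ∆ ((c i ∆ z) ∘ h))) ^ 2 =
        ∑ i, ∑ j, ∑ x, ∑ h : ι → κ, g (x ∆ ((c i ∆ z) ∘ h)) * g (x ∆ ((c j ∆ z) ∘ h)) := by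
      simp_rw [sq, Finset.sum_mul_sum]
      rw [Finset.sum_congr rfl fun x _ => Finset.sum_comm, Finset.sum_comm]
      refine Finset.sum_congr rfl fun i _ => ?_
      rw [Finset.sum_congr rfl fun x _ => Finset.sum_comm, Finset.sum_comm]
    have hoff : ∀ i j, i ≠ j →
        ∑ x, ∑ h : ι → κ, g (x ∆ ((c i ∆ z) ∘ h)) * g (x ∆ ((c j ∆ z) ∘ h)) = 0 := by
      intro i j hij
      refine sum_symmDiff_comp_mul_eq_zero hg (m := m) ?_
      rw [symmDiff_comm (c j) z, symmDiff_assoc, symmDiff_symmDiff_cancel_left]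
      exact hc i j hij
    have hdiag : ∀ i, ∑ x, ∑ h : ι → κ, g (x ∆ ((c i ∆ z) ∘ h)) * g (x ∆ ((c i ∆ z) ∘ h)) ≤
        2 ^ Fintype.card ι * (Fintype.card κ : ℝ) ^ Fintype.card ι := by
      intro i
      calc _ ≤ ∑ x : ι → Bool, ∑ h : ι → κ, (1 : ℝ) := by
            refine Finset.sum_le_sum fun x _ => Finset.sum_le_sum fun h _ => ?_
            rw [← abs_mul_abs_self]
            exact mul_le_one₀ (hg1 _) (abs_nonneg _) (hg1 _)
        _ = _ := by simp
    rw [e]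
    calc _ = ∑ i, ∑ x, ∑ h : ι → κ, g (x ∆ ((c i ∆ z) ∘ h)) * g (x ∆ ((c i ∆ z) ∘ h)) := by
          refine Finset.sum_congr rfl fun i _ => ?_
          exact Finset.sum_eq_single_of_mem i (Finset.mem_univ _) fun j _ hj => hoff i j hj.symm
      _ ≤ ∑ i : Fin r, 2 ^ Fintype.card ι * (Fintype.card κ : ℝ) ^ Fintype.card ι :=
          Finset.sum_le_sum fun i _ => hdiag i
      _ = _ := by simp
  -- As `z` varies, the translated words cover the subcube exactly `r` times. Cauchy–Schwarz passes
  -- to the squares.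
  have havg : ∀ x (h : ι → κ), ((r : ℝ) * ∑ z : κ → Bool, g (x ∆ (z ∘ h))) ^ 2 ≤
      2 ^ Fintype.card κ * ∑ z : κ → Bool, (∑ i, g (x ∆ ((c i ∆ z) ∘ h))) ^ 2 := by
    intro x h
    have e : (r : ℝ) * ∑ z : κ → Bool, g (x ∆ (z ∘ h)) =
        ∑ z : κ → Bool, ∑ i, g (x ∆ ((c i ∆ z) ∘ h)) := by
      rw [Finset.sum_comm]
      simp_rw [fun i => sum_symmDiff (c i) fun z : κ → Bool => g (x ∆ (z ∘ h))]
      simp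
    rw [e]
    refine sq_sum_le_card_mul_sum_sq.trans_eq ?_
    simp
  have key : (r : ℝ) * (r * ∑ x, ∑ h : ι → κ, (∑ z : κ → Bool, g (x ∆ (z ∘ h))) ^ 2) ≤
      r * ((2 ^ Fintype.card κ) ^ 2 *
        (2 ^ Fintype.card ι * (Fintype.card κ : ℝ) ^ Fintype.card ι)) := by
    calc _ = ∑ x, ∑ h : ι → κ, ((r : ℝ) * ∑ z : κ → Bool, g (x ∆ (z ∘ h))) ^ 2 := by
          simp_rw [mul_pow, ← Finset.mul_sum]
          ring
      _ ≤ ∑ x, ∑ h : ι → κ,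
          2 ^ Fintype.card κ * ∑ z : κ → Bool, (∑ i, g (x ∆ ((c i ∆ z) ∘ h))) ^ 2 :=
          Finset.sum_le_sum fun x _ => Finset.sum_le_sum fun h _ => havg x h
      _ = 2 ^ Fintype.card κ * ∑ z : κ → Bool,
          ∑ x, ∑ h : ι → κ, (∑ i, g (x ∆ ((c i ∆ z) ∘ h))) ^ 2 := by
          simp_rw [← Finset.mul_sum]
          rw [Finset.sum_congr rfl fun x _ => Finset.sum_comm, Finset.sum_comm]
      _ ≤ 2 ^ Fintype.card κ * ∑ z : κ → Bool,
          (r : ℝ) * (2 ^ Fintype.card ι * (Fintype.card κ : ℝ) ^ Fintype.card ι) := by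
          gcongr with z _
          exact hcoset z
      _ = _ := by
          simp only [Finset.sum_const, Finset.card_univ, Fintype.card_fun, Fintype.card_bool,
            nsmul_eq_mul]
          push_cast
          ring
  exact le_of_mul_le_mul_left key hr'

/-- The `r` coordinate functions on `{0,1}^r` serve as the words: flipping bit `i` exchanges the
places where coordinates `i` and `j` agree and differ. -/
theorem card_filter_coordinate_symmDiff {r : ℕ} {i j : Fin r} (hij : i ≠ j) (b : Bool) :
    (Finset.univ.filter fun k : Fin r → Bool =>
      ((fun k : Fin r → Bool => k i) ∆ (fun k : Fin r → Bool => k j)) k = b).card = 2 ^ (r - 1) := by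
  have hflip : (Finset.univ.filter fun k : Fin r → Bool =>
      ((fun k : Fin r → Bool => k i) ∆ (fun k : Fin r → Bool => k j)) k = b).card =
      (Finset.univ.filter fun k : Fin r → Bool =>
        ¬ ((fun k : Fin r → Bool => k i) ∆ (fun k : Fin r → Bool => k j)) k = b).card := by
    refine Finset.card_nbij' (fun k => Function.update k i (!k i))
      (fun k => Function.update k i (!k i)) ?_ ?_ ?_ ?_
    · intro k hk
      simp [hij.symm, Pi.symmDiff_apply] at hk ⊢
      revert hk
      cases k i <;> cases k j <;> cases b <;> simp
    · intro k hk
      simp [hij.symm, Pi.symmDiff_apply] at hk ⊢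
      revert hk
      cases k i <;> cases k j <;> cases b <;> simp
    · intro k _
      simp
    · intro k _
      simp
  have h := Finset.card_filter_add_card_filter_not (s := (Finset.univ : Finset (Fin r → Bool)))
    fun k => ((fun k : Fin r → Bool => k i) ∆ (fun k : Fin r → Bool => k j)) k = b
  rw [← hflip] at h
  simp only [Finset.card_univ, Fintype.card_fun, Fintype.card_bool, Fintype.card_fin] at h
  have hr : 2 ^ r = 2 * 2 ^ (r - 1) := by
    rw [← pow_succ', Nat.sub_add_cancel (Nat.one_le_of_lt i.isLt)]
  omega

/-- Random subcubes of dimension `2 ^ r` are samplers: the mean over such a subcube of a bounded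
function of mean zero exceeds `τ` with probability at most `1 / (r τ ^ 2)`. -/
theorem card_bad_subcube_le {g : (ι → Bool) → ℝ} (hg : ∑ x, g x = 0) (hg1 : ∀ x, |g x| ≤ 1)
    (r : ℕ) {τ : ℝ} (hτ : 0 ≤ τ) :
    r * τ ^ 2 * ∑ x, ((Finset.univ.filter fun h : ι → Fin r → Bool =>
        τ * 2 ^ (2 ^ r) ≤ ∑ z : (Fin r → Bool) → Bool, g (x ∆ (z ∘ h))).card : ℝ) ≤
      2 ^ Fintype.card ι * (2 ^ r) ^ Fintype.card ι := by
  have h1 := sum_sq_sum_subcube_le hg hg1 (c := fun (i : Fin r) (k : Fin r → Bool) => k i)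
    fun i j hij => card_filter_coordinate_symmDiff hij
  simp only [Fintype.card_fun, Fintype.card_bool, Fintype.card_fin, Nat.cast_pow,
    Nat.cast_ofNat] at h1
  -- Chebyshev's inequality: each bad `h` contributes at least the squared threshold to the second
  -- moment.
  have h2 : ∑ x, (τ * 2 ^ (2 ^ r)) ^ 2 * ((Finset.univ.filter fun h : ι → Fin r → Bool =>
        τ * 2 ^ (2 ^ r) ≤ ∑ z : (Fin r → Bool) → Bool, g (x ∆ (z ∘ h))).card : ℝ) ≤
      ∑ x, ∑ h : ι → Fin r → Bool, (∑ z : (Fin r → Bool) → Bool, g (x ∆ (z ∘ h))) ^ 2 := by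
    refine Finset.sum_le_sum fun x _ => ?_
    rw [mul_comm, ← nsmul_eq_mul]
    refine (Finset.card_nsmul_le_sum _ (fun h : ι → Fin r → Bool =>
      (∑ z : (Fin r → Bool) → Bool, g (x ∆ (z ∘ h))) ^ 2) _ ?_).trans
      (Finset.sum_le_sum_of_subset_of_nonneg (Finset.subset_univ _) fun _ _ _ => sq_nonneg _)
    intro h hh
    exact pow_le_pow_left₀ (by positivity) (Finset.mem_filter.1 hh).2 2
  rw [← Finset.mul_sum] at h2
  have h3 := (mul_le_mul_of_nonneg_left h2 (Nat.cast_nonneg (α := ℝ) r)).trans h1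
  refine le_of_mul_le_mul_left (le_trans (le_of_eq ?_) h3)
    (show (0 : ℝ) < (2 ^ (2 ^ r)) ^ 2 by positivity)
  ring

end Sampling

/-! ### Nonadaptive query algorithms and trivial cases. -/

theorem QueryAlg.exists_nonadaptive {n : ℕ} {G : Type*} (m : ℕ) (p : Fin m → BoolCube n)
    (Φ : (Fin m → G) → G) :
    ∃ A : QueryAlg n G, ∀ f, A.output f = Φ (f ∘ p) ∧ A.numQueries f = m := by
  induction m with
  | zero =>
    refine ⟨.ret (Φ Fin.elim0), fun f => ⟨?_, rfl⟩⟩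
    rw [QueryAlg.output]
    congr 1
    exact Subsingleton.elim _ _
  | succ m ih =>
    choose A hA using fun g : G => ih (p ∘ Fin.succ) fun v => Φ (Fin.cons g v)
    refine ⟨.query (p 0) A, fun f => ⟨?_, ?_⟩⟩
    · rw [QueryAlg.output, (hA _ f).1]
      congr 1
      ext i
      refine Fin.cases ?_ (fun i => ?_) i <;> simp
    · rw [QueryAlg.numQueries, (hA _ f).2]

theorem QueryAlg.exists_nonadaptive_of_fintype {n : ℕ} {G I : Type*} [Fintype I]
    (p : I → BoolCube n) (Φ : (I → G) → G) :
    ∃ A : QueryAlg n G, ∀ f, A.output f = Φ (f ∘ p) ∧ A.numQueries f = Fintype.card I := by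
  obtain ⟨A, hA⟩ := QueryAlg.exists_nonadaptive (G := G) (Fintype.card I)
    (p ∘ (Fintype.equivFin I).symm) fun v => Φ (v ∘ Fintype.equivFin I)
  refine ⟨A, fun f => ⟨?_, (hA f).2⟩⟩
  rw [(hA f).1]
  congr 1
  ext i
  simp

theorem HasLocalCorrection.mono {n : ℕ} {G : Type*} {F : Set (BoolCube n → G)} {δ : ℝ} {q q' : ℕ}
    (h : HasLocalCorrection F δ q) (hq : q ≤ q') : HasLocalCorrection F δ q' := by
  obtain ⟨A, h1, h2⟩ := h
  exact ⟨A, fun f a s => (h1 f a s).trans hq, h2⟩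

theorem HasLocalCorrection.of_neg {n : ℕ} {G : Type*} [Nonempty G] (F : Set (BoolCube n → G))
    {δ : ℝ} (hδ : δ < 0) : HasLocalCorrection F δ 0 := by
  refine ⟨⟨Unit, fun _ _ => .ret (Classical.arbitrary G)⟩, fun _ _ _ => le_rfl, ?_⟩
  intro f P _ h
  exact absurd (h.trans_lt hδ) (not_lt.2 (by unfold relDist; positivity))

/-! ### The corrector and its failure probability. -/

section Corrector

variable {n d r : ℕ} {G : Type*}

open Classical in
/-- The centred indicator of the set of points at which `f` and `P` differ. -/
noncomputable def centredError (f P : BoolCube n → G) (x : BoolCube n) : ℝ :=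
  (if f x ≠ P x then 1 else 0) - relDist f P

theorem sum_centredError (f P : BoolCube n → G) : ∑ x, centredError f P x = 0 := by
  simp only [centredError, Finset.sum_sub_distrib, Finset.sum_boole, relDist, hammingDist]
  simp
  field_simp
  simp

theorem relDist_nonneg (f P : BoolCube n → G) : 0 ≤ relDist f P := by
  unfold relDist
  positivity

theorem relDist_le_one (f P : BoolCube n → G) : relDist f P ≤ 1 := by
  classical
  unfold relDist
  rw [div_le_one (by positivity)]
  have := hammingDist_le_card_fintype (x := f) (y := P)
  simp only [Fintype.card_fun, Fintype.card_bool, Fintype.card_fin] at this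
  convert (Nat.cast_le (α := ℝ)).2 this
  simp

theorem abs_centredError_le_one (f P : BoolCube n → G) (x : BoolCube n) :
    |centredError f P x| ≤ 1 := by
  have h0 := relDist_nonneg f P
  have h1 := relDist_le_one f P
  unfold centredError
  rw [abs_le]
  split_ifs <;> constructor <;> linarith

/-- The error rate on the subcube is `relDist f P` plus the mean centred error, hence below `1 / 2 ^
(d + 1)`; the origin of the subcube is `x`. -/
theorem decodeAtBot_subcube_eq [AddCommGroup G] {f P : BoolCube n → G} (hP : P ∈ polySpace d n G) {ε : ℝ}
    (hfP : relDist f P ≤ 1 / 2 ^ (d + 1) - ε) (x : BoolCube n) (h : Fin n → Fin r → Bool)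
    (hx : ∑ z : (Fin r → Bool) → Bool, centredError f P (x ∆ (z ∘ h)) < ε * 2 ^ (2 ^ r)) :
    decodeAtBot d (fun z : (Fin r → Bool) → Bool => f (x ∆ (z ∘ h))) = P x := by
  classical
  rw [decodeAtBot_eq (polySpace_comp_mem_juntaSpan hP x h)]
  · congr 1
    exact symmDiff_bot x
  · have h1 : ∑ z : (Fin r → Bool) → Bool, centredError f P (x ∆ (z ∘ h)) =
        (hammingDist (fun z : (Fin r → Bool) → Bool => f (x ∆ (z ∘ h)))
          (fun z => P (x ∆ (z ∘ h))) : ℝ) - 2 ^ (2 ^ r) * relDist f P := by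
      simp only [centredError, Finset.sum_sub_distrib, Finset.sum_boole, hammingDist]
      simp
    rw [h1] at hx
    have h2 : (0 : ℝ) < 2 ^ (2 ^ r) := by positivity
    have h3 := mul_le_mul_of_nonneg_left hfP h2.le
    have h4 : (hammingDist (fun z : (Fin r → Bool) → Bool => f (x ∆ (z ∘ h)))
          (fun z => P (x ∆ (z ∘ h))) : ℝ) < 2 ^ (2 ^ r) / 2 ^ (d + 1) := by
      rw [div_eq_mul_one_div]
      linarith
    rw [lt_div_iff₀' (by positivity)] at h4
    have h5 : Fintype.card (Fin r → Bool) = 2 ^ r := by simp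
    rw [h5]
    convert show 2 ^ (d + 1) * hammingDist (fun z : (Fin r → Bool) → Bool => f (x ∆ (z ∘ h)))
      (fun z => P (x ∆ (z ∘ h))) < 2 ^ (2 ^ r) by exact_mod_cast h4

theorem card_filter_decide_mem {κ : Type*} [Fintype κ] [DecidableEq κ] {L : ℕ}
    (hκ : Fintype.card κ = 2 * L) {A : Finset κ} (hA : A.card = L) (b : Bool) :
    (Finset.univ.filter fun j => decide (j ∈ A) = b).card = L := by
  cases b
  · have : (Finset.univ.filter fun j => decide (j ∈ A) = false) = Aᶜ := by ext; simp
    rw [this, Finset.card_compl]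
    omega
  · simpa using hA

/-- Over a balanced random choice of base point, a random subcube is bad with probability at most
`1 / (r ε ^ 2)`. -/
theorem card_bad_seed_le {g : BoolCube n → ℝ} (hg : ∑ x, g x = 0) (hg1 : ∀ x, |g x| ≤ 1)
    {L : ℕ} {A : Finset (Fin (2 * L))} (hA : A.card = L) (a : BoolCube n) {ε : ℝ} (hε : 0 ≤ ε) :
    r * ε ^ 2 * ((Finset.univ.filter fun s : (Fin n → Fin (2 * L)) × (Fin n → Fin r → Bool) =>
      ε * 2 ^ (2 ^ r) ≤ ∑ z : (Fin r → Bool) → Bool,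
        g (a ∆ ((fun j => decide (j ∈ A)) ∘ s.1) ∆ (z ∘ s.2))).card : ℝ) ≤
      Fintype.card ((Fin n → Fin (2 * L)) × (Fin n → Fin r → Bool)) := by
  have h1 := card_bad_subcube_le hg hg1 r hε
  set B : BoolCube n → ℝ := fun x => ((Finset.univ.filter fun h : Fin n → Fin r → Bool =>
        ε * 2 ^ (2 ^ r) ≤ ∑ z : (Fin r → Bool) → Bool, g (x ∆ (z ∘ h))).card : ℝ) with hB
  have h2 : ((Finset.univ.filter fun s : (Fin n → Fin (2 * L)) × (Fin n → Fin r → Bool) =>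
      ε * 2 ^ (2 ^ r) ≤ ∑ z : (Fin r → Bool) → Bool,
        g (a ∆ ((fun j => decide (j ∈ A)) ∘ s.1) ∆ (z ∘ s.2))).card : ℝ) =
      ∑ h : Fin n → Fin (2 * L), B (a ∆ ((fun j => decide (j ∈ A)) ∘ h)) := by
    simp only [hB, ← Finset.sum_boole]
    rw [Fintype.sum_prod_type]
  rw [h2, sum_comp_balanced (card_filter_decide_mem (by simp) hA) fun x => B (a ∆ x), sum_symmDiff]
  simp only [Fintype.card_prod, Fintype.card_fun, Fintype.card_fin, Fintype.card_bool] at h1 ⊢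
  calc _ = (L : ℝ) ^ n * (r * ε ^ 2 * ∑ x, B x) := by ring
    _ ≤ (L : ℝ) ^ n * (2 ^ n * (2 ^ r) ^ n) := by gcongr
    _ = _ := by
      push_cast
      rw [mul_pow]
      ring

/-- The hypothesis on `r` is what the union bound needs: there are at most `2 ^ (2 * L)` base
points, each bad with probability at most `1 / (r ε ^ 2)`, for a total of at most `1 / 4`. -/
theorem hasLocalCorrection_polySpace [AddCommGroup G] {M : ℕ} (hM : 0 < M) (hG : ∀ g : G, M • g = 0) {ε : ℝ}
    (hε : 0 < ε)
    (hr : 4 * (2 : ℝ) ^ (2 * (M * d.factorial)) ≤ r * ε ^ 2) :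
    HasLocalCorrection (polySpace d n G) (1 / (2 : ℝ) ^ (d + 1) - ε)
      (2 ^ (2 * (M * d.factorial)) * 2 ^ (2 ^ r)) := by
  classical
  set L := M * d.factorial with hL
  have hdL : d ≤ L := (Nat.self_le_factorial d).trans (Nat.le_mul_of_pos_left _ hM)
  have hLpos : 0 < L := Nat.mul_pos hM d.factorial_pos
  obtain ⟨U, -, hU⟩ := Finset.exists_subset_card_eq
    (show L + d ≤ (Finset.univ : Finset (Fin (2 * L))).card by simp; omega)
  have : Nonempty (Fin (2 * L)) := ⟨⟨0, by omega⟩⟩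
  -- Queries are made for every subset `A` of the blocks, though only those of size `L` inside `U`
  -- are used; this fixes the count `2 ^ (2 * L) * 2 ^ (2 ^ r)`.
  choose alg halg using fun (s : (Fin n → Fin (2 * L)) × (Fin n → Fin r → Bool)) (a : BoolCube n) =>
    QueryAlg.exists_nonadaptive_of_fintype (G := G)
      (fun i : Finset (Fin (2 * L)) × ((Fin r → Bool) → Bool) =>
        a ∆ ((fun j => decide (j ∈ i.1)) ∘ s.1) ∆ (i.2 ∘ s.2))
      fun v => ∑ A ∈ U.powersetCard L, decodeAtBot d fun z => v (A, z)
  refine ⟨⟨_, alg⟩, fun f a s => ?_, fun f P hP hfP a => ?_⟩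
  · rw [(halg s a f).2]
    simp
  set Bad : Finset (Fin (2 * L)) → Finset ((Fin n → Fin (2 * L)) × (Fin n → Fin r → Bool)) :=
    fun A => Finset.univ.filter fun s => ε * 2 ^ (2 ^ r) ≤ ∑ z : (Fin r → Bool) → Bool,
        centredError f P (a ∆ ((fun j => decide (j ∈ A)) ∘ s.1) ∆ (z ∘ s.2)) with hBad
  have hgood : ∀ s ∉ (U.powersetCard L).biUnion Bad, (alg s a).output f = P a := by
    intro s hs
    rw [(halg s a f).1]
    have h1 : ∀ A ∈ U.powersetCard L,
        decodeAtBot d (fun z : (Fin r → Bool) → Bool =>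
          f (a ∆ ((fun j => decide (j ∈ A)) ∘ s.1) ∆ (z ∘ s.2))) =
        P (a ∆ ((fun j => decide (j ∈ A)) ∘ s.1)) := by
      intro A hA
      refine decodeAtBot_subcube_eq hP hfP _ _ ?_
      by_contra hcon
      exact hs (Finset.mem_biUnion.2 ⟨A, hA, by simpa [hBad] using not_lt.1 hcon⟩)
    refine (Finset.sum_congr rfl h1).trans ?_
    refine (sum_powersetCard_eq_bot hG hdL hU (polySpace_comp_mem_juntaSpan hP a s.1)).trans ?_
    congr 1
    exact symmDiff_bot a
  set N := Fintype.card ((Fin n → Fin (2 * L)) × (Fin n → Fin r → Bool)) with hN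
  have hNpos : (0 : ℝ) < N := by
    rw [hN]
    exact_mod_cast Fintype.card_pos
  have hbad : (((U.powersetCard L).biUnion Bad).card : ℝ) ≤ N / 4 := by
    have h1 : r * ε ^ 2 * (((U.powersetCard L).biUnion Bad).card : ℝ) ≤
        (U.powersetCard L).card * N := by
      calc _ ≤ r * ε ^ 2 * ∑ A ∈ U.powersetCard L, ((Bad A).card : ℝ) := by
            gcongr
            exact_mod_cast Finset.card_biUnion_le
        _ = ∑ A ∈ U.powersetCard L, r * ε ^ 2 * ((Bad A).card : ℝ) := Finset.mul_sum _ _ _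
        _ ≤ ∑ A ∈ U.powersetCard L, (N : ℝ) := Finset.sum_le_sum fun A hA =>
            card_bad_seed_le (sum_centredError f P) (abs_centredError_le_one f P)
              (Finset.mem_powersetCard.1 hA).2 a hε.le
        _ = _ := by simp
    have h2 : ((U.powersetCard L).card : ℝ) ≤ 2 ^ (2 * L) := by
      have := Finset.card_le_univ (U.powersetCard L)
      simp only [Fintype.card_finset, Fintype.card_fin] at this
      exact_mod_cast this
    have h3 : (4 * (2 : ℝ) ^ (2 * L)) * (((U.powersetCard L).biUnion Bad).card : ℝ) ≤
        2 ^ (2 * L) * N :=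
      (mul_le_mul_of_nonneg_right hr (Nat.cast_nonneg _)).trans
        (h1.trans (mul_le_mul_of_nonneg_right h2 hNpos.le))
    refine le_of_mul_le_mul_left (h3.trans_eq' ?_ |>.trans_eq ?_)
      (show (0 : ℝ) < 4 * 2 ^ (2 * L) by positivity)
    · rfl
    · ring
  unfold ProbQueryAlg.probOutput
  rw [le_div_iff₀ hNpos]
  have hsub : ((U.powersetCard L).biUnion Bad)ᶜ ⊆
      Finset.univ.filter fun s => (alg s a).output f = P a := by
    intro s hs
    exact Finset.mem_filter.2 ⟨Finset.mem_univ _, hgood s (Finset.mem_compl.1 hs)⟩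
  have hle := Finset.card_le_card hsub
  rw [Finset.card_compl] at hle
  have hle' : (N : ℝ) ≤ ((Finset.univ.filter fun s => (alg s a).output f = P a).card : ℝ) +
      (((U.powersetCard L).biUnion Bad).card : ℝ) := by
    exact_mod_cast Nat.sub_le_iff_le_add.1 hle
  convert show 3 / 4 * (N : ℝ) ≤
    ((Finset.univ.filter fun s => (alg s a).output f = P a).card : ℝ) by linarith

end Corrector

theorem theorem1p2 (M : ℕ) (hM : 0 < M) (ε : ℝ) (hε : 0 < ε) :
    ∃ q : ℕ, ∀ (d : ℕ) (G : Type*) [AddCommGroup G], AddMonoid.exponent G = M →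
      ∀ n : ℕ, HasLocalCorrection (polySpace d n G) (1 / (2 : ℝ) ^ (d + 1) - ε) q := by
  have hr : ∀ d : ℕ, ∃ r : ℕ, 4 * (2 : ℝ) ^ (2 * (M * d.factorial)) ≤ r * ε ^ 2 := by
    intro d
    obtain ⟨r, hr⟩ := exists_nat_ge (4 * (2 : ℝ) ^ (2 * (M * d.factorial)) / ε ^ 2)
    exact ⟨r, (div_le_iff₀ (by positivity)).1 hr⟩
  choose r hr using hr
  -- For `d ≥ D` the radius is negative and the claim is vacuous, so a maximum over `d < D` gives a
  -- `q` independent of `d`.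
  obtain ⟨D, hD⟩ := exists_pow_lt_of_lt_one hε (show (1 / 2 : ℝ) < 1 by norm_num)
  refine ⟨(Finset.range D).sup fun d => 2 ^ (2 * (M * d.factorial)) * 2 ^ (2 ^ r d),
    fun d G _ hG n => ?_⟩
  by_cases hd : d < D
  · refine (hasLocalCorrection_polySpace hM (fun g => ?_) hε (hr d)).mono
      (Finset.le_sup (f := fun d => 2 ^ (2 * (M * d.factorial)) * 2 ^ (2 ^ r d))
        (Finset.mem_range.2 hd))
    rw [← hG]
    exact AddMonoid.exponent_nsmul_eq_zero g
  · refine (HasLocalCorrection.of_neg _ ?_).mono (Nat.zero_le _)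
    have h1 : (1 / 2 : ℝ) ^ (d + 1) ≤ (1 / 2) ^ D :=
      pow_le_pow_of_le_one (by norm_num) (by norm_num) (by omega)
    rw [one_div_pow] at h1
    linarith
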